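/- For $n\ge 0$ let $\mathcal T_n$ be the set of full binary trees with $n+1$ leaves. For $t\in\mathcal T_n$, with leaves labelled $0,1,\dots,n$ from left to right, let $\mathrm{ld}_i(t)$ (resp. $\mathrm{rd}_i(t)$) be the number of left (resp. right) steps on the path from the root to leaf $i$. For $d\ge1$ let $C^d_n$ be the number of equivalence classes of $\mathcal T_n$ under the relation $t\sim t'$ defined by: for every $i=0,\dots,n$, $\min\{\mathrm{ld}_i(t),\mathrm{ld}_i(t')\}<d$ implies $\mathrm{ld}_i(t)=\mathrm{ld}_i(t')$, and $\min\{\mathrm{rd}_i(t),\mathrm{rd}_i(t')\}<1$ implies $\mathrm{rd}_i(t)=\mathrm{rd}_i(t')$. (If $*$ is a binary operation on a set $A$ such that, for all $n$, two trees $t,t'\in\mathcal T_n$ give parenthesizations of $a_0*\cdots*a_n$ that are equal as functions $A^{n+1}\to A$ exactly when $t\sim t'$, then $C^d_n$ is the number of different functions $A^{n+1}\to A$ obtained by parenthesizing $a_0*\cdots*a_n$.) **Proposition.** Let $\mathbb F$ be a field, $n\ge0$, and let $\mathcal U_n$ be the algebra of $n\times n$ upper triangular matrices over $\mathbb F$.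 For a nilpotent two-sided ideal $I$ of $\mathcal U_n$, let the order of $I$ be $\inf\{m : I^m=0\}$. For every $d\ge1$, the number of nilpotent two-sided ideals of $\mathcal U_n$ of order at most $d$ equals $C^d_n$. This generalizes Shapiro's count of commutative ideals: if $n\ge2$, the two-sided ideals of $\mathcal U_n$ whose elements commute with each other are exactly the nilpotent two-sided ideals of order at most $2$, and there are $2^{n-1}$ of them. -/

import Mathlib

/-!
Full binary trees, depths of leaves, the `(*, n)`-classes of a binary operation `*`, the numbers
`C^{d,e}_{k,ℓ,n}` and `C^d_n`, the algebra of upper triangular matrices and its nilpotent ideals.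
-/

/-- Full binary trees with `n + 1` leaves (`BinaryTree.nil` is a leaf, and every internal node of a
`BinaryTree Unit` has exactly two children). -/
abbrev FullTree (n : ℕ) : Type := {t : BinaryTree Unit // t.numLeaves = n + 1}

theorem FullTree.finite (n : ℕ) : Finite (FullTree n) := by
  refine Finite.of_injective
    (fun t : FullTree n => (⟨t.1, ?_⟩ : {t : BinaryTree Unit // t ∈ BinaryTree.treesOfNumNodesEq n}))
    ?_
  · have h := t.2
    rw [BinaryTree.numLeaves_eq_numNodes_succ] at h
    rw [BinaryTree.mem_treesOfNumNodesEq]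
    omega
  · intro s t h
    exact Subtype.ext (congrArg (fun u => u.1) h)

/-- The left depths `ld_0(t), …, ld_n(t)` of the leaves of `t`, read from left to right: the number
of left steps on the path from the root to each leaf. -/
def leftDepths : BinaryTree Unit → List ℕ
  | .nil => [0]
  | .node _ l r => (leftDepths l).map (· + 1) ++ leftDepths r

/-- The right depths `rd_0(t), …, rd_n(t)` of the leaves of `t`, read from left to right. -/
def rightDepths : BinaryTree Unit → List ℕ
  | .nil => [0]
  | .node _ l r => rightDepths l ++ (rightDepths r).map (· + 1)

/-- The relation `b ∼_k^d c` on two sequences of natural numbers of the same length: for every `i`,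
`b_i ≡ c_i (mod k)`, and `min {b_i, c_i} < d` implies `b_i = c_i`. -/
def DepthRel (d k : ℕ) : List ℕ → List ℕ → Prop :=
  List.Forall₂ fun b c => b ≡ c [MOD k] ∧ (min b c < d → b = c)

theorem DepthRel.refl (d k : ℕ) (b : List ℕ) : DepthRel d k b b :=
  List.forall₂_same.2 fun _ _ => ⟨rfl, fun _ => rfl⟩

theorem DepthRel.symm {d k : ℕ} {b c : List ℕ} (h : DepthRel d k b c) : DepthRel d k c b := by
  induction h with
  | nil => exact .nil
  | cons h _ ih => exact .cons ⟨h.1.symm, fun hm => (h.2 (by omega)).symm⟩ ih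

theorem DepthRel.trans {d k : ℕ} {a b c : List ℕ} (h : DepthRel d k a b) (h' : DepthRel d k b c) :
    DepthRel d k a c := by
  induction h generalizing c with
  | nil => cases h'; exact .nil
  | cons h _ ih =>
    cases h' with
    | cons g hs =>
      refine .cons ⟨h.1.trans g.1, fun hm => ?_⟩ (ih hs)
      have h2 := h.2
      have g2 := g.2
      omega

/-- The equivalence relation on full binary trees with `n + 1` leaves given by
`ld(t) ∼_k^d ld(t')` and `rd(t) ∼_ℓ^e rd(t')`. -/
def depthSetoid (d e k l n : ℕ) : Setoid (FullTree n) where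
  r t t' := DepthRel d k (leftDepths t.1) (leftDepths t'.1) ∧
    DepthRel e l (rightDepths t.1) (rightDepths t'.1)
  iseqv :=
    { refl := fun _ => ⟨DepthRel.refl _ _ _, DepthRel.refl _ _ _⟩
      symm := fun h => ⟨h.1.symm, h.2.symm⟩
      trans := fun h h' => ⟨h.1.trans h'.1, h.2.trans h'.2⟩ }

/-- The number `C^{d,e}_{k,ℓ,n}` of classes of full binary trees with `n + 1` leaves under
`ld(t) ∼_k^d ld(t')` and `rd(t) ∼_ℓ^e rd(t')`. By `numClasses_eq` below, this is the number of
`(*, n)`-classes of any binary operation `*` that is governed by this relation. -/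
noncomputable def depthNumber (d e k l n : ℕ) : ℕ := Nat.card (Quotient (depthSetoid d e k l n))

/-- The number `C^d_n = C^{d,1}_{1,1,n}`. -/
noncomputable def catalanDepth (d n : ℕ) : ℕ := depthNumber d 1 1 1 n

/-- The value of the parenthesization encoded by a tree, at a tuple of arguments indexed by the
leaves from left to right. -/
def evalTree {A : Type*} (op : A → A → A) : (t : BinaryTree Unit) → (Fin t.numLeaves → A) → A
  | .nil, a => a ⟨0, by simp⟩
  | .node _ l r, a =>
    op (evalTree op l fun i => a (Fin.castAdd r.numLeaves i))
      (evalTree op r fun i => a (Fin.natAdd l.numLeaves i))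

/-- The parenthesization of `a_0 * ⋯ * a_n` encoded by `t`, as a function `A^{n+1} → A`. -/
def parenthesization {A : Type*} (op : A → A → A) {n : ℕ} (t : FullTree n) :
    (Fin (n + 1) → A) → A :=
  fun a => evalTree op t.1 fun i => a (Fin.cast t.2 i)

/-- `(*, n)`-equivalence: the two parenthesizations are equal as functions `A^{n+1} → A`. -/
def opSetoid {A : Type*} (op : A → A → A) (n : ℕ) : Setoid (FullTree n) :=
  Setoid.ker (parenthesization op (n := n))

/-- The number `C_{*,n}` of `(*, n)`-classes. -/
noncomputable def numClasses {A : Type*} (op : A → A → A) (n : ℕ) : ℕ :=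
  Nat.card (Quotient (opSetoid op n))

/-- For every `n`, two trees are `(*, n)`-equivalent if and only if `ld(t) ∼_k^d ld(t')` and
`rd(t) ∼_ℓ^e rd(t')`. -/
def IsGovernedByDepth {A : Type*} (op : A → A → A) (d e k l : ℕ) : Prop :=
  ∀ (n : ℕ) (t t' : FullTree n), opSetoid op n t t' ↔
    DepthRel d k (leftDepths t.1) (leftDepths t'.1) ∧
      DepthRel e l (rightDepths t.1) (rightDepths t'.1)

theorem numClasses_eq {A : Type*} {op : A → A → A} {d e k l : ℕ}
    (h : IsGovernedByDepth op d e k l) (n : ℕ) : numClasses op n = depthNumber d e k l n := by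
  have : opSetoid op n = depthSetoid d e k l n := Setoid.ext fun t t' => h n t t'
  rw [numClasses, depthNumber, this]

/-- The algebra `𝒰_n` of upper triangular `n × n` matrices over `F`. -/
abbrev UpperTriangular (F : Type*) [Field F] (n : ℕ) : Subalgebra F (Matrix (Fin n) (Fin n) F) :=
  Matrix.blockTriangularSubalgebra F F (id : Fin n → Fin n)

/-- The two-sided ideals `I` of `R` that are nilpotent of order at most `d`, the order of `I` being
`nilpotencyClass I = inf {m | I ^ m = 0}`. -/
def nilpotentIdeals (R : Type*) [Ring R] (d : ℕ) : Set (Ideal R) :=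
  {I | I.IsTwoSided ∧ IsNilpotent I ∧ nilpotencyClass I ≤ d}

/-- The two-sided ideals of `R` any two elements of which commute. -/
def commutativeIdeals (R : Type*) [Ring R] : Set (Ideal R) :=
  {I | I.IsTwoSided ∧ ∀ a ∈ I, ∀ b ∈ I, a * b = b * a}

/-! Both sides count plane trees with `n` edges and height at most `d`, whose series is
`heightSeries (d + 1)`, given by H_0 = 0 and H_{e+1} = 1 + X H_e H_{e+1}.

Ideals: a two-sided ideal is closed under moving a nonzero entry up or to the right, so it is a
staircase with monotone column heights `h j` (`exists_eq_supportIdeal`). Nilpotency forces `h j ≤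
j`, so `h j` can be read as the parent of node `j + 1` in a tree on 0, …, n labelled breadth first.
Multiplying by the ideal climbs one generation, so I^d = 0 exactly when the tree has height at most
`d` (`supportIdeal_pow_eq_bot_iff`). These trees are counted by `parentExtensions_count`.

Binary trees: the condition on right depths is vacuous, so C^d_n counts left depth sequences cut off
at `d`. Splitting at the root gives the recursion of H (`card_truncatedDepths_succ`). The
commutative case is d = 2, where H_3 = (1 - X)/(1 - 2X). -/

/-- The generating function, by number of edges, of the plane trees of height less than `e`. -/
noncomputable def heightSeries : ℕ → PowerSeries ℚ
  | 0 => 0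
  | e + 1 => (1 - PowerSeries.X * heightSeries e)⁻¹

theorem heightSeries_succ (e : ℕ) :
    heightSeries (e + 1) = 1 + PowerSeries.X * heightSeries e * heightSeries (e + 1) := by
  have h : (1 - PowerSeries.X * heightSeries e) * heightSeries (e + 1) = 1 :=
    PowerSeries.mul_inv_cancel _ (by simp)
  linear_combination h

theorem constantCoeff_heightSeries_succ (e : ℕ) :
    PowerSeries.constantCoeff (heightSeries (e + 1)) = 1 := by
  rw [heightSeries_succ]
  simp

/-! ### Counting breadth first labelled trees of bounded height -/

/-- The depth of a node in the tree with root `0` in which the parent of `i + 1` is `h i`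
(cut off at `i`). -/
def parentDepth (h : ℕ → ℕ) : ℕ → ℕ
  | 0 => 0
  | i + 1 => parentDepth h (min (h i) i) + 1

theorem parentDepth_zero (h : ℕ → ℕ) : parentDepth h 0 = 0 := by
  rw [parentDepth]

theorem parentDepth_succ (h : ℕ → ℕ) {i : ℕ} (hi : h i ≤ i) :
    parentDepth h (i + 1) = parentDepth h (h i) + 1 := by
  rw [parentDepth, min_eq_left hi]

theorem parentDepth_congr {h g : ℕ → ℕ} {p : ℕ} (hg : ∀ i < p, h i = g i) :
    ∀ i ≤ p, parentDepth h i = parentDepth g i := by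
  intro i
  induction i using Nat.strong_induction_on with
  | _ i ih =>
    intro hi
    match i with
    | 0 => rw [parentDepth_zero, parentDepth_zero]
    | i + 1 =>
      rw [parentDepth, parentDepth, hg i (by omega), ih _ (by omega) (by omega)]

/-- Passing to parents preserves the order of nodes and lowers both depths by one, so the comparison
descends to the root. -/
theorem parentDepth_mono {h : ℕ → ℕ} {n : ℕ} (hm : ∀ i j, i ≤ j → j < n → h i ≤ h j)
    (hi : ∀ i < n, h i ≤ i) : ∀ j ≤ n, ∀ i ≤ j, parentDepth h i ≤ parentDepth h j := by
  intro j
  induction j using Nat.strong_induction_on with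
  | _ j ih =>
    intro hj i hij
    match i, j with
    | 0, _ => rw [parentDepth_zero]; exact Nat.zero_le _
    | i + 1, j + 1 =>
      rw [parentDepth_succ h (hi i (by omega)), parentDepth_succ h (hi j (by omega))]
      have := hi j (by omega)
      have := ih (h j) (by omega) (by omega) (h i) (hm i j (by omega) (by omega))
      omega

/-- The monotone parent functions of trees with `n` edges and height at most `d`, that is, the
breadth first labelled plane trees. -/
def parentFunctions (d n : ℕ) : Set (ℕ → ℕ) :=
  {h | (∀ i, n ≤ i → h i = 0) ∧ (∀ i j, i ≤ j → j < n → h i ≤ h j) ∧ (∀ i < n, h i ≤ i) ∧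
    ∀ i ≤ n, parentDepth h i ≤ d}

/-- The parent functions that start like `g` on the first `p` places and go on with a value that is
at least `v`. -/
def parentExtensions (d n p v : ℕ) (g : ℕ → ℕ) : Set (ℕ → ℕ) :=
  {h | h ∈ parentFunctions d n ∧ (∀ i < p, h i = g i) ∧ (p < n → v ≤ h p)}

theorem parentExtensions_split {d n p v : ℕ} (hp : p < n) (g : ℕ → ℕ) :
    parentExtensions d n p v g = parentExtensions d n p (v + 1) g ∪
      parentExtensions d n (p + 1) v (Function.update g p v) := by
  ext h
  simp only [parentExtensions, Set.mem_ofPred_eq, Set.mem_union]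
  constructor
  · rintro ⟨hh, hg, hv⟩
    rcases (hv hp).lt_or_eq with h1 | h1
    · exact Or.inl ⟨hh, hg, fun _ => h1⟩
    · refine Or.inr ⟨hh, fun i hi => ?_, fun h2 => ?_⟩
      · rcases (Nat.lt_succ_iff.1 hi).lt_or_eq with h3 | h3
        · rw [Function.update_of_ne h3.ne, hg i h3]
        · subst h3; rw [Function.update_self, h1]
      · rw [h1]; exact hh.2.1 _ _ (by omega) h2
  · rintro (⟨hh, hg, hv⟩ | ⟨hh, hg, hv⟩)
    · exact ⟨hh, hg, fun h => by have := hv h; omega⟩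
    · refine ⟨hh, fun i hi => ?_, fun _ => ?_⟩
      · rw [hg i (by omega), Function.update_of_ne hi.ne]
      · rw [hg p (by omega), Function.update_self]

theorem parentExtensions_disjoint {d n p v : ℕ} (hp : p < n) (g : ℕ → ℕ) :
    Disjoint (parentExtensions d n p (v + 1) g)
      (parentExtensions d n (p + 1) v (Function.update g p v)) := by
  rw [Set.disjoint_left]
  rintro h ⟨_, _, h1⟩ ⟨_, h2, _⟩
  have := h1 hp
  have h3 := h2 p (by omega)
  rw [Function.update_self] at h3
  omega

theorem parentExtensions_full {d n v : ℕ} {g : ℕ → ℕ}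
    (hm : ∀ i j, i ≤ j → j < n → g i ≤ g j) (hi : ∀ i < n, g i ≤ i)
    (hd : ∀ i ≤ n, parentDepth g i ≤ d) :
    parentExtensions d n n v g = {fun i => if i < n then g i else 0} := by
  ext h
  simp only [parentExtensions, Set.mem_ofPred_eq, Set.mem_singleton_iff, lt_irrefl, false_imp_iff,
    and_true]
  constructor
  · rintro ⟨hh, hg⟩
    funext i
    split_ifs with h1
    · exact hg i h1
    · exact hh.1 i (by omega)
  · intro hh
    have hg : ∀ i < n, h i = g i := fun i h1 => by rw [hh]; exact if_pos h1
    refine ⟨⟨fun i h1 => by rw [hh]; exact if_neg (by omega), fun i j h1 h2 => ?_, fun i h1 => ?_,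
      fun i h1 => ?_⟩, hg⟩
    · rw [hg i (by omega), hg j h2]; exact hm i j h1 h2
    · rw [hg i h1]; exact hi i h1
    · rw [parentDepth_congr hg i h1]; exact hd i h1

/-- Nodes 0, …, p are placed and exactly v, …, p may still receive children. A node of depth δ will
carry a subtree of height less than d + 1 - δ, hence the product of series; `m` is the number of
edges still to be placed. -/
theorem parentExtensions_count (d n : ℕ) : ∀ m p v : ℕ, ∀ g : ℕ → ℕ, p + m = n → v ≤ p + 1 →
    (∀ i j, i ≤ j → j < p → g i ≤ g j) → (∀ i < p, g i ≤ i) → (∀ i < p, g i ≤ v) →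
    (∀ i ≤ p, parentDepth g i ≤ d) →
    (parentExtensions d n p v g).Finite ∧ ((parentExtensions d n p v g).ncard : ℚ) =
      PowerSeries.coeff m (∏ i ∈ Finset.Icc v p, heightSeries (d + 1 - parentDepth g i)) := by
  intro m
  induction m with
  | zero =>
    intro p v g hp hv hm hi hgv hd
    obtain rfl : p = n := hp
    rw [parentExtensions_full hm hi hd]
    refine ⟨Set.finite_singleton _, ?_⟩
    rw [Set.ncard_singleton, PowerSeries.coeff_zero_eq_constantCoeff_apply, map_prod,
      Finset.prod_eq_one, Nat.cast_one]
    intro i h1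
    have := hd i (Finset.mem_Icc.1 h1).2
    rw [Nat.sub_add_comm this, constantCoeff_heightSeries_succ]
  | succ m ih =>
    intro p v g hp hv hm hi hgv hd
    -- Inner induction on the number of nodes still open: the next parent is either beyond `v`,
    -- which closes `v`, or equal to `v`, which opens node `p + 1` and uses up one edge.
    induction hk : p + 1 - v generalizing v with
    | zero =>
      have he : parentExtensions d n p v g = ∅ := by
        rw [Set.eq_empty_iff_forall_notMem]
        rintro h ⟨hh, _, hv'⟩
        have := hv' (by omega)
        have := hh.2.2.1 p (by omega)
        omega
      rw [he, Finset.Icc_eq_empty (by omega)]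
      simp [PowerSeries.coeff_one]
    | succ k ihk =>
      have hpn : p < n := by omega
      have hvp : v ≤ p := by omega
      obtain ⟨f1, c1⟩ := ihk (v + 1) (by omega) (fun i h => (hgv i h).trans (by omega)) (by omega)
      have hdv := hd v hvp
      set g' := Function.update g p v with hg'
      have hgg : ∀ i < p, g' i = g i := fun i h => Function.update_of_ne h.ne _ _
      have hgp : g' p = v := Function.update_self ..
      have hdg : ∀ i ≤ p, parentDepth g' i = parentDepth g i := parentDepth_congr hgg
      have hdp : parentDepth g' (p + 1) = parentDepth g v + 1 := by
        rw [parentDepth_succ _ (hgp.le.trans hvp), hgp, hdg v hvp]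
      have hQ : (∏ i ∈ Finset.Icc v (p + 1), heightSeries (d + 1 - parentDepth g' i)) =
          heightSeries (d - parentDepth g v) *
            ∏ i ∈ Finset.Icc v p, heightSeries (d + 1 - parentDepth g i) := by
        rw [Finset.prod_Icc_succ_top (by omega), hdp, mul_comm]
        congr 1
        · congr 1; omega
        · refine Finset.prod_congr rfl fun i h => ?_
          rw [hdg i (Finset.mem_Icc.1 h).2]
      have h2 : (parentExtensions d n (p + 1) v g').Finite ∧
          ((parentExtensions d n (p + 1) v g').ncard : ℚ) = PowerSeries.coeff m
            (heightSeries (d - parentDepth g v) *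
              ∏ i ∈ Finset.Icc v p, heightSeries (d + 1 - parentDepth g i)) := by
        rcases hdv.lt_or_eq with hlt | heq
        · rw [← hQ]
          refine ih (p + 1) v g' (by omega) (by omega) ?_ ?_ ?_ ?_
          · intro i j hij hj
            rcases (Nat.lt_succ_iff.1 hj).lt_or_eq with h3 | h3
            · rw [hgg i (by omega), hgg j h3]; exact hm i j hij h3
            · rw [h3, hgp]
              rcases (hij.trans h3.le).lt_or_eq with h4 | h4
              · rw [hgg i h4]; exact hgv i h4
              · rw [h4, hgp]
          · intro i hj
            rcases (Nat.lt_succ_iff.1 hj).lt_or_eq with h3 | h3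
            · rw [hgg i h3]; exact hi i h3
            · rw [h3, hgp]; exact hvp
          · intro i hj
            rcases (Nat.lt_succ_iff.1 hj).lt_or_eq with h3 | h3
            · rw [hgg i h3]; exact hgv i h3
            · rw [h3, hgp]
          · intro i hj
            rcases hj.lt_or_eq with h3 | h3
            · rw [hdg i (by omega)]; exact hd i (by omega)
            · rw [h3, hdp]; omega
        -- A child of a node of depth `d` would be too deep; this matches H_0 = 0.
        · have he : parentExtensions d n (p + 1) v g' = ∅ := by
            rw [Set.eq_empty_iff_forall_notMem]
            rintro h ⟨hh, hg, _⟩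
            have h3 := hh.2.2.2 (p + 1) (by omega)
            rw [parentDepth_congr hg (p + 1) le_rfl, hdp] at h3
            omega
          rw [he, heq, Nat.sub_self, heightSeries]
          simp
      obtain ⟨f2, c2⟩ := h2
      rw [parentExtensions_split hpn]
      refine ⟨f1.union f2, ?_⟩
      rw [Set.ncard_union_eq (parentExtensions_disjoint hpn g) f1 f2, Nat.cast_add, c1, c2,
        ← PowerSeries.coeff_succ_X_mul m (heightSeries _ * _), ← map_add, ← Finset.mul_prod_Ioc_eq_prod_Icc hvp,
        Nat.sub_add_comm hdv, Finset.Icc_add_one_left_eq_Ioc]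
      congr 1
      -- The two cases are the two summands of H_{e+1} = 1 + X H_e H_{e+1} for the factor of `v`.
      linear_combination (-∏ i ∈ Finset.Ioc v p, heightSeries (d + 1 - parentDepth g i)) *
        heightSeries_succ (d - parentDepth g v)

theorem encard_parentFunctions (d n : ℕ) {c : ℕ}
    (hc : (c : ℚ) = PowerSeries.coeff n (heightSeries (d + 1))) :
    (parentFunctions d n).encard = c := by
  have h := parentExtensions_count d n n 0 0 (fun _ => 0) (by omega) (by omega) (by simp) (by simp)
    (by simp) (fun i hi => by
      obtain rfl : i = 0 := by omega
      rw [parentDepth_zero]; exact Nat.zero_le _)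
  have he : parentExtensions d n 0 0 (fun _ => 0) = parentFunctions d n := by
    ext h; simp [parentExtensions]
  rw [he] at h
  rw [← h.1.cast_ncard_eq]
  have h2 := h.2
  simp only [Finset.Icc_self, Finset.prod_singleton, parentDepth_zero, Nat.sub_zero, ← hc] at h2
  exact_mod_cast h2

/-! ### Depth sequences of binary trees -/

theorem length_leftDepths (t : BinaryTree Unit) : (leftDepths t).length = t.numLeaves := by
  induction t with
  | nil => rfl
  | node a l r hl hr => simp [leftDepths, BinaryTree.numLeaves, hl, hr]

theorem length_rightDepths (t : BinaryTree Unit) : (rightDepths t).length = t.numLeaves := by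
  induction t with
  | nil => rfl
  | node a l r hl hr => simp [rightDepths, BinaryTree.numLeaves, hl, hr]

theorem leftDepths_eq_append (t : BinaryTree Unit) :
    ∃ s : List ℕ, leftDepths t = s ++ [0] ∧ ∀ x ∈ s, 0 < x := by
  induction t with
  | nil => exact ⟨[], rfl, by simp⟩
  | node a l r hl hr =>
    obtain ⟨s, hs, h⟩ := hr
    refine ⟨(leftDepths l).map (· + 1) ++ s, by simp [leftDepths, hs], fun x hx => ?_⟩
    rcases List.mem_append.1 hx with h1 | h1
    · obtain ⟨y, -, rfl⟩ := List.mem_map.1 h1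
      exact Nat.succ_pos y
    · exact h x h1

theorem rightDepths_eq_cons (t : BinaryTree Unit) :
    ∃ s : List ℕ, rightDepths t = 0 :: s ∧ ∀ x ∈ s, 0 < x := by
  induction t with
  | nil => exact ⟨[], rfl, by simp⟩
  | node a l r hl hr =>
    obtain ⟨s, hs, h⟩ := hl
    refine ⟨s ++ (rightDepths r).map (· + 1), by simp [rightDepths, hs], fun x hx => ?_⟩
    rcases List.mem_append.1 hx with h1 | h1
    · exact h x h1
    · obtain ⟨y, -, rfl⟩ := List.mem_map.1 h1
      exact Nat.succ_pos y

theorem depthRel_one_iff {d : ℕ} {b c : List ℕ} :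
    DepthRel d 1 b c ↔ b.map (min d) = c.map (min d) := by
  rw [← List.forall₂_eq_eq_eq, List.forall₂_map_left_iff, List.forall₂_map_right_iff, DepthRel]
  have : (fun b c : ℕ => b ≡ c [MOD 1] ∧ (min b c < d → b = c)) =
      fun b c => min d b = min d c := by
    funext b c
    simp only [Nat.modEq_one, true_and, eq_iff_iff]
    omega
  rw [this]

theorem map_min_one_of_pos {s : List ℕ} (h : ∀ x ∈ s, 0 < x) :
    s.map (min 1) = List.replicate s.length 1 := by
  rw [List.eq_replicate_iff]
  refine ⟨by simp, fun b hb => ?_⟩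
  obtain ⟨x, hx, rfl⟩ := List.mem_map.1 hb
  exact min_eq_left (h x hx)

/-- Only the leftmost leaf has right depth 0, in every tree, so cutting off at 1 forgets everything
but the length. -/
theorem depthRel_one_rightDepths {t t' : BinaryTree Unit} (h : t.numLeaves = t'.numLeaves) :
    DepthRel 1 1 (rightDepths t) (rightDepths t') := by
  obtain ⟨s, hs, h1⟩ := rightDepths_eq_cons t
  obtain ⟨s', hs', h2⟩ := rightDepths_eq_cons t'
  have h3 := length_rightDepths t
  have h4 := length_rightDepths t'
  rw [hs, List.length_cons] at h3
  rw [hs', List.length_cons] at h4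
  rw [depthRel_one_iff, hs, hs', List.map_cons, List.map_cons, map_min_one_of_pos h1,
    map_min_one_of_pos h2, show s.length = s'.length by omega]

/-- The left depth sequences of the full binary trees with `n + 1` leaves, cut off at `d`. -/
def truncatedDepths (d n : ℕ) : Finset (List ℕ) :=
  (BinaryTree.treesOfNumNodesEq n).image fun t => (leftDepths t).map (min d)

theorem catalanDepth_eq_card (d n : ℕ) : catalanDepth d n = (truncatedDepths d n).card := by
  let f : FullTree n → List ℕ := fun t => (leftDepths t.1).map (min d)
  have h : depthSetoid d 1 1 1 n = Setoid.ker f := Setoid.ext fun t t' =>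
    ⟨fun h => depthRel_one_iff.1 h.1, fun h => ⟨depthRel_one_iff.2 h,
      depthRel_one_rightDepths (t.2.trans t'.2.symm)⟩⟩
  rw [catalanDepth, depthNumber, h, Nat.card_congr (Setoid.quotientKerEquivRange f),
    ← Nat.card_eq_finsetCard]
  refine Nat.card_congr (Equiv.setCongr (Set.ext fun x => ?_))
  simp only [f, Set.mem_range, truncatedDepths, Finset.mem_coe, Finset.mem_image,
    BinaryTree.mem_treesOfNumNodesEq, Subtype.exists, BinaryTree.numLeaves_eq_numNodes_succ,
    Nat.add_right_cancel_iff, exists_prop]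

/-- The left block ends at the first entry equal to 1, so the cut is determined by the
concatenation. -/
theorem eq_of_map_succ_append {s s' r r' : List ℕ} (hs : ∀ x ∈ s, 0 < x) (hs' : ∀ x ∈ s', 0 < x)
    (h : (s ++ [0]).map (· + 1) ++ r = (s' ++ [0]).map (· + 1) ++ r') : s = s' ∧ r = r' := by
  induction s generalizing s' with
  | nil =>
    cases s' with
    | nil => simpa using h
    | cons y s' => have := hs' y (by simp); simp at h; omega
  | cons x s ih =>
    cases s' with
    | nil => have := hs x (by simp); simp at h; omega
    | cons y s' =>
      simp only [List.cons_append, List.map_cons, List.cons.injEq, Nat.add_right_cancel_iff] at h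
      obtain ⟨h1, h2⟩ := ih (fun x hx => hs x (by simp [hx])) (fun x hx => hs' x (by simp [hx])) h.2
      exact ⟨by rw [h.1, h1], h2⟩

theorem exists_of_mem_truncatedDepths {d n : ℕ} {l : List ℕ} (h : l ∈ truncatedDepths (d + 1) n) :
    l.length = n + 1 ∧ ∃ s : List ℕ, l = s ++ [0] ∧ ∀ x ∈ s, 0 < x := by
  obtain ⟨t, ht, rfl⟩ := Finset.mem_image.1 h
  rw [BinaryTree.mem_treesOfNumNodesEq] at ht
  obtain ⟨s, hs, h1⟩ := leftDepths_eq_append t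
  refine ⟨by rw [List.length_map, length_leftDepths, BinaryTree.numLeaves_eq_numNodes_succ, ht],
    s.map (min (d + 1)), by simp [hs], fun x hx => ?_⟩
  obtain ⟨y, hy, rfl⟩ := List.mem_map.1 hx
  have := h1 y hy
  omega

theorem truncatedDepths_succ (d n : ℕ) : truncatedDepths (d + 1) (n + 1) =
    (Finset.HasAntidiagonal.antidiagonal n).biUnion fun ij => Finset.image₂ (fun l r => l.map (· + 1) ++ r)
      (truncatedDepths d ij.1) (truncatedDepths (d + 1) ij.2) := by
  ext x
  simp only [truncatedDepths, BinaryTree.treesOfNumNodesEq_succ, Finset.mem_image,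
    Finset.mem_biUnion, Finset.mem_image₂, BinaryTree.pairwiseNode, Finset.mem_map,
    Finset.mem_product]
  have key : ∀ l r : BinaryTree Unit, (leftDepths (.node () l r)).map (min (d + 1)) =
      ((leftDepths l).map (min d)).map (· + 1) ++ (leftDepths r).map (min (d + 1)) := by
    intro l r
    simp only [leftDepths, List.map_append, List.map_map]
    congr 2
    funext x
    simp
  constructor
  · rintro ⟨t, ⟨ij, hij, ⟨l, r⟩, ⟨hl, hr⟩, rfl⟩, rfl⟩
    exact ⟨ij, hij, _, ⟨l, hl, rfl⟩, _, ⟨r, hr, rfl⟩, (key l r).symm⟩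
  · rintro ⟨ij, hij, _, ⟨l, hl, rfl⟩, _, ⟨r, hr, rfl⟩, rfl⟩
    exact ⟨_, ⟨ij, hij, (l, r), ⟨hl, hr⟩, rfl⟩, key l r⟩

/-- The left blocks are cut off at `d + 1`, which is positive: this keeps their final 0
distinguishable and makes the root splitting unique. -/
theorem card_truncatedDepths_succ (d n : ℕ) : (truncatedDepths (d + 2) (n + 1)).card =
    ∑ ij ∈ Finset.HasAntidiagonal.antidiagonal n,
      (truncatedDepths (d + 1) ij.1).card * (truncatedDepths (d + 2) ij.2).card := by
  have key : ∀ {i j : ℕ} {l l' r r' : List ℕ}, l ∈ truncatedDepths (d + 1) i →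
      l' ∈ truncatedDepths (d + 1) j → l.map (· + 1) ++ r = l'.map (· + 1) ++ r' →
      l = l' ∧ r = r' := by
    intro i j l l' r r' hl hl' h
    obtain ⟨-, s, rfl, hs⟩ := exists_of_mem_truncatedDepths hl
    obtain ⟨-, s', rfl, hs'⟩ := exists_of_mem_truncatedDepths hl'
    obtain ⟨rfl, h2⟩ := eq_of_map_succ_append hs hs' h
    exact ⟨rfl, h2⟩
  rw [truncatedDepths_succ, Finset.card_biUnion]
  · refine Finset.sum_congr rfl fun ij _ => ?_
    rw [Finset.card_image₂_iff]
    rintro ⟨l, r⟩ h ⟨l', r'⟩ h' heq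
    obtain ⟨rfl, rfl⟩ := key h.1 h'.1 heq
    rfl
  · rintro ⟨i, j⟩ hij ⟨i', j'⟩ hij' hne
    rw [Function.onFun, Finset.disjoint_left]
    intro x hx hx'
    obtain ⟨l, hl, r, hr, rfl⟩ := Finset.mem_image₂.1 hx
    obtain ⟨l', hl', r', hr', heq⟩ := Finset.mem_image₂.1 hx'
    obtain ⟨rfl, rfl⟩ := key hl hl' heq.symm
    have h1 := (exists_of_mem_truncatedDepths hl).1
    have h2 := (exists_of_mem_truncatedDepths hl').1
    have h3 := (exists_of_mem_truncatedDepths hr).1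
    have h4 := (exists_of_mem_truncatedDepths hr').1
    exact hne (Prod.ext (by simp at *; omega) (by simp at *; omega))

theorem card_truncatedDepths_one (n : ℕ) : (truncatedDepths 1 n).card = 1 := by
  rw [Finset.card_eq_one]
  refine ⟨List.replicate n 1 ++ [0], ?_⟩
  have key : ∀ t ∈ BinaryTree.treesOfNumNodesEq n,
      (leftDepths t).map (min 1) = List.replicate n 1 ++ [0] := by
    intro t ht
    rw [BinaryTree.mem_treesOfNumNodesEq] at ht
    obtain ⟨s, hs, h1⟩ := leftDepths_eq_append t
    have h2 := length_leftDepths t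
    rw [BinaryTree.numLeaves_eq_numNodes_succ, ht, hs, List.length_append,
      List.length_singleton] at h2
    rw [hs, List.map_append, map_min_one_of_pos h1, show s.length = n by omega]
    rfl
  rw [truncatedDepths, Finset.image_congr key, Finset.image_const]
  rw [← Finset.card_pos, BinaryTree.treesOfNumNodesEq_card_eq_catalan, catalan_eq_centralBinom_div]
  exact Nat.div_pos (Nat.le_of_dvd (Nat.centralBinom_pos n) (Nat.succ_dvd_centralBinom n))
    n.succ_pos

theorem card_truncatedDepths_zero (d : ℕ) : (truncatedDepths d 0).card = 1 := by
  rw [truncatedDepths, BinaryTree.treesOfNumNodesEq_zero, Finset.image_singleton,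
    Finset.card_singleton]

/-! ### Comparison with the height series -/

theorem heightSeries_one : heightSeries 1 = 1 := by
  rw [heightSeries_succ, heightSeries]; simp

theorem coeff_heightSeries_two (n : ℕ) : PowerSeries.coeff n (heightSeries 2) = 1 := by
  induction n with
  | zero => rw [PowerSeries.coeff_zero_eq_constantCoeff_apply, constantCoeff_heightSeries_succ]
  | succ n ih =>
    rw [heightSeries_succ, heightSeries_one, mul_one, map_add, PowerSeries.coeff_succ_X_mul, ih]
    simp [PowerSeries.coeff_one]

theorem coeff_heightSeries_succ (e n : ℕ) :
    PowerSeries.coeff (n + 1) (heightSeries (e + 1)) = ∑ ij ∈ Finset.HasAntidiagonal.antidiagonal n,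
      PowerSeries.coeff ij.1 (heightSeries e) * PowerSeries.coeff ij.2 (heightSeries (e + 1)) := by
  conv_lhs => rw [heightSeries_succ, map_add, mul_assoc, PowerSeries.coeff_succ_X_mul,
    PowerSeries.coeff_mul]
  simp [PowerSeries.coeff_one]

theorem card_truncatedDepths (d n : ℕ) : ((truncatedDepths (d + 1) n).card : ℚ) =
    PowerSeries.coeff n (heightSeries (d + 2)) := by
  induction d generalizing n with
  | zero => rw [card_truncatedDepths_one, coeff_heightSeries_two, Nat.cast_one]
  | succ d ihd =>
    induction n using Nat.strong_induction_on with
    | _ n ih =>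
      cases n with
      | zero =>
        rw [card_truncatedDepths_zero, PowerSeries.coeff_zero_eq_constantCoeff_apply,
          constantCoeff_heightSeries_succ, Nat.cast_one]
      | succ n =>
        rw [card_truncatedDepths_succ, coeff_heightSeries_succ, Nat.cast_sum]
        refine Finset.sum_congr rfl fun ij hij => ?_
        have := Finset.HasAntidiagonal.mem_antidiagonal.1 hij
        rw [Nat.cast_mul, ihd, ih ij.2 (by omega)]

theorem cast_catalanDepth {d : ℕ} (hd : 1 ≤ d) (n : ℕ) :
    (catalanDepth d n : ℚ) = PowerSeries.coeff n (heightSeries (d + 1)) := by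
  obtain ⟨d, rfl⟩ := Nat.exists_eq_add_of_le' hd
  rw [catalanDepth_eq_card, card_truncatedDepths]

theorem coeff_heightSeries_three (n : ℕ) :
    PowerSeries.coeff (n + 1) (heightSeries 3) = (2 : ℚ) ^ n := by
  have h : heightSeries 3 =
      1 + PowerSeries.X * (heightSeries 3 + heightSeries 3 - 1) := by
    have h2 := heightSeries_succ 1
    rw [heightSeries_one] at h2
    linear_combination (1 - PowerSeries.X) * heightSeries_succ 2 +
      PowerSeries.X * heightSeries 3 * h2
  induction n with
  | zero =>
    rw [h, map_add, PowerSeries.coeff_succ_X_mul, map_sub, map_add,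
      PowerSeries.coeff_zero_eq_constantCoeff_apply, constantCoeff_heightSeries_succ]
    simp [PowerSeries.coeff_one]
  | succ n ih =>
    rw [h, map_add, PowerSeries.coeff_succ_X_mul, map_sub, map_add, ih]
    simp [PowerSeries.coeff_one]
    ring

/-! ### Two-sided ideals as staircases -/

section TwoSidedIdeals

variable {F : Type*} [Field F] {n : ℕ}

theorem UpperTriangular.le_of_ne_zero (A : UpperTriangular F n) {i j : Fin n}
    (h : A.1 i j ≠ 0) : i ≤ j := by
  by_contra hij
  exact h (A.2 (not_le.1 hij))

theorem UpperTriangular.exists_of_mul_ne_zero (A B : UpperTriangular F n) {i j : Fin n}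
    (h : (A * B).1 i j ≠ 0) : ∃ k, A.1 i k ≠ 0 ∧ B.1 k j ≠ 0 := by
  have h1 : (A.1 * B.1) i j ≠ 0 := h
  rw [Matrix.mul_apply] at h1
  obtain ⟨k, -, hk⟩ := Finset.exists_ne_zero_of_sum_ne_zero h1
  exact ⟨k, left_ne_zero_of_mul hk, right_ne_zero_of_mul hk⟩

/-- The upper triangular matrix whose only nonzero entry is `c`, at place `(i, j)` with `i ≤ j`. -/
noncomputable def upperSingle {i j : Fin n} (hij : i ≤ j) (c : F) : UpperTriangular F n :=
  ⟨Matrix.single i j c, fun a b hab => by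
    rw [Matrix.single_apply]
    refine if_neg ?_
    rintro ⟨rfl, rfl⟩
    exact absurd hij (not_le.2 hab)⟩

theorem upperSingle_apply_same {i j : Fin n} (hij : i ≤ j) (c : F) :
    (upperSingle hij c).1 i j = c :=
  Matrix.single_apply_same i j c

theorem upperSingle_ne_zero {i j : Fin n} (hij : i ≤ j) : upperSingle hij (1 : F) ≠ 0 := by
  intro h
  have h1 := upperSingle_apply_same hij (1 : F)
  rw [h] at h1
  exact zero_ne_one h1

theorem upperSingle_mul {i j k : Fin n} (hij : i ≤ j) (hjk : j ≤ k) (c c' : F) :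
    upperSingle hij c * upperSingle hjk c' = upperSingle (hij.trans hjk) (c * c') :=
  Subtype.ext (Matrix.single_mul_single_same ..)

theorem upperSingle_mul_of_ne {i j k l : Fin n} (hij : i ≤ j) (hkl : k ≤ l) (h : j ≠ k) (c c' : F) :
    upperSingle hij c * upperSingle hkl c' = 0 :=
  Subtype.ext (Matrix.single_mul_single_of_ne (h := h) ..)

/-- Multiplying by matrix units on both sides isolates the entry, rescales it and moves it up and to
the right. -/
theorem upperSingle_mem {I : Ideal (UpperTriangular F n)} [I.IsTwoSided]
    {A : UpperTriangular F n} (hA : A ∈ I) {i j i' j' : Fin n} (h : A.1 i j ≠ 0) (hi : i' ≤ i)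
    (hj : j ≤ j') (hij : i' ≤ j') (c : F) : upperSingle hij c ∈ I := by
  have h1 : upperSingle hij c = upperSingle hi (c * (A.1 i j)⁻¹) * A * upperSingle hj 1 := by
    refine Subtype.ext ?_
    change Matrix.single i' j' c =
      Matrix.single i' i (c * (A.1 i j)⁻¹) * A.1 * Matrix.single j j' 1
    rw [Matrix.single_mul_mul_single, mul_one, mul_assoc, inv_mul_cancel₀ h, mul_one]
  rw [h1]
  exact I.mul_mem_right _ (I.mul_mem_left _ hA)

theorem UpperTriangular.mem_of_forall_upperSingle {I : Ideal (UpperTriangular F n)}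
    {A : UpperTriangular F n}
    (h : ∀ i j, ∀ hij : i ≤ j, A.1 i j ≠ 0 → upperSingle hij (A.1 i j) ∈ I) : A ∈ I := by
  have h1 : A = ∑ i, ∑ j, if hij : i ≤ j then upperSingle hij (A.1 i j) else 0 := by
    refine Subtype.ext ?_
    rw [AddSubmonoidClass.coe_finsetSum]
    conv_lhs => rw [Matrix.matrix_eq_sum_single A.1]
    refine Finset.sum_congr rfl fun i _ => ?_
    rw [AddSubmonoidClass.coe_finsetSum]
    refine Finset.sum_congr rfl fun j _ => ?_
    split_ifs with hij
    · rfl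
    · have h2 : A.1 i j = 0 := by
        by_contra h2
        exact hij (UpperTriangular.le_of_ne_zero A h2)
      rw [h2, Matrix.single_zero]
      rfl
  rw [h1]
  refine Submodule.sum_mem _ fun i _ => Submodule.sum_mem _ fun j _ => ?_
  split_ifs with hij
  · by_cases h2 : A.1 i j = 0
    · have h3 : upperSingle hij (A.1 i j) = 0 := by
        rw [h2]
        exact Subtype.ext (Matrix.single_zero i j)
      rw [h3]
      exact I.zero_mem
    · exact h i j hij h2
  · exact I.zero_mem

variable (F n) in
/-- The upper triangular matrices whose nonzero entries in column `j` lie in the first `h j`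
rows. -/
def supportIdeal (h : ℕ → ℕ) : Ideal (UpperTriangular F n) where
  carrier := {A | ∀ i j, A.1 i j ≠ 0 → (i : ℕ) < h j}
  zero_mem' := fun _ _ h => absurd rfl h
  add_mem' := by
    intro A B hA hB i j hij
    by_contra hlt
    have h1 : A.1 i j = 0 := by
      by_contra h1
      exact hlt (hA i j h1)
    have h2 : B.1 i j = 0 := by
      by_contra h1
      exact hlt (hB i j h1)
    refine hij ?_
    change A.1 i j + B.1 i j = 0
    rw [h1, h2, add_zero]
  smul_mem' := by
    intro B A hA i j hij
    obtain ⟨k, h1, h2⟩ := UpperTriangular.exists_of_mul_ne_zero B A hij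
    have h3 : (i : ℕ) ≤ k := UpperTriangular.le_of_ne_zero B h1
    exact h3.trans_lt (hA k j h2)

theorem supportIdeal_isTwoSided {h : ℕ → ℕ} (hm : ∀ i j, i ≤ j → j < n → h i ≤ h j) :
    (supportIdeal F n h).IsTwoSided := by
  refine ⟨fun {A} B hA i j hij => ?_⟩
  obtain ⟨k, h1, h2⟩ := UpperTriangular.exists_of_mul_ne_zero A B hij
  exact (hA i k h1).trans_le (hm _ _ (UpperTriangular.le_of_ne_zero B h2) j.2)

theorem upperSingle_mem_supportIdeal {h : ℕ → ℕ} {i j : Fin n} (hij : i ≤ j) :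
    upperSingle hij (1 : F) ∈ supportIdeal F n h ↔ (i : ℕ) < h j := by
  constructor
  · intro h1
    refine h1 i j ?_
    rw [upperSingle_apply_same]
    exact one_ne_zero
  · intro h1 a b hab
    change Matrix.single i j (1 : F) a b ≠ 0 at hab
    rw [Matrix.single_apply] at hab
    obtain ⟨rfl, rfl⟩ : i = a ∧ j = b := by
      by_contra h2
      exact hab (if_neg h2)
    exact h1

/-- The rows where column `j` can be nonzero form an initial segment, which grows with `j`; `h j` is
its length. -/
theorem exists_eq_supportIdeal (I : Ideal (UpperTriangular F n)) [I.IsTwoSided] :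
    ∃ h : ℕ → ℕ, (∀ i, n ≤ i → h i = 0) ∧ (∀ i j, i ≤ j → j < n → h i ≤ h j) ∧
      I = supportIdeal F n h := by
  classical
  let P : ℕ → ℕ → Prop := fun j i => ∃ (hi : i < n) (hj : j < n), ∃ A ∈ I, A.1 ⟨i, hi⟩ ⟨j, hj⟩ ≠ 0
  have hP : ∀ j, ∃ i, ¬ P j i := fun j => ⟨n, fun ⟨h, _⟩ => lt_irrefl _ h⟩
  have hmono : ∀ {i j i' j'}, P j i → i' ≤ i → j ≤ j' → j' < n → P j' i' := by
    rintro i j i' j' ⟨hi, hj, A, hA, h⟩ hi' hj' hn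
    have hij : i ≤ j := UpperTriangular.le_of_ne_zero A h
    have h1 : (⟨i', by omega⟩ : Fin n) ≤ ⟨j', hn⟩ := Fin.mk_le_mk.2 (by omega)
    refine ⟨by omega, hn, upperSingle h1 1,
      upperSingle_mem hA h (Fin.mk_le_mk.2 hi') (Fin.mk_le_mk.2 hj') h1 1, ?_⟩
    rw [upperSingle_apply_same]
    exact one_ne_zero
  have hlt : ∀ j i, i < Nat.find (hP j) ↔ P j i := by
    intro j i
    constructor
    · intro h
      exact not_not.1 (Nat.find_min (hP j) h)
    · intro h
      by_contra h1
      obtain ⟨_, hj, _⟩ := id h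
      exact Nat.find_spec (hP j) (hmono h (not_lt.1 h1) le_rfl hj)
  refine ⟨fun j => Nat.find (hP j), fun j hj => ?_, fun i j hij hj => ?_, le_antisymm ?_ ?_⟩
  · rw [Nat.find_eq_zero]
    rintro ⟨_, h, _⟩
    omega
  · by_contra h
    rw [not_le, hlt] at h
    exact Nat.find_spec (hP j) (hmono h le_rfl hij hj)
  · intro A hA i j hij
    rw [hlt]
    exact ⟨i.2, j.2, A, hA, hij⟩
  · intro A hA
    refine UpperTriangular.mem_of_forall_upperSingle fun i j hij h => ?_
    have h1 := hA i j h
    rw [hlt] at h1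
    obtain ⟨_, _, B, hB, h2⟩ := h1
    exact upperSingle_mem hB h2 le_rfl le_rfl hij _

/-! ### Powers of a staircase and the height of its tree -/

/-- Row `i` and column `j` stand for nodes `i + 1` and `j + 1`, node 0 being the extra root. An
entry of the ideal at `(k, j)` has `k + 1` at most the parent of `j + 1`, so each factor costs at
least one level. -/
theorem le_parentDepth_of_mem_pow {h : ℕ → ℕ} (hm : ∀ i j, i ≤ j → j < n → h i ≤ h j)
    (hi : ∀ i < n, h i ≤ i) (m : ℕ) {A : UpperTriangular F n} (hA : A ∈ supportIdeal F n h ^ m)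
    {i j : Fin n} (hij : A.1 i j ≠ 0) :
    parentDepth h (i + 1) + m ≤ parentDepth h (j + 1) := by
  induction m generalizing A j with
  | zero =>
    have : (i : ℕ) ≤ j := UpperTriangular.le_of_ne_zero A hij
    exact parentDepth_mono hm hi _ j.2 _ (by omega)
  | succ m ih =>
    rw [Submodule.pow_succ] at hA
    induction hA using Submodule.mul_induction_on' with
    | mem_mul_mem B hB C hC =>
      obtain ⟨k, h1, h2⟩ := UpperTriangular.exists_of_mul_ne_zero B C hij
      have h3 := ih hB h1
      have h4 := hi j j.2
      have h5 := parentDepth_mono hm hi (h j) (by omega) (k + 1) (hC k j h2)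
      rw [parentDepth_succ h h4]
      omega
    | add B _ C _ hB hC =>
      by_cases h1 : B.1 i j = 0
      · refine hC fun h2 => hij ?_
        change B.1 i j + C.1 i j = 0
        rw [h1, h2, add_zero]
      · exact hB h1

/-- The matrix units joining each node to its parent lie in the ideal; multiply them along the
ancestors of `j + 1`, stopping at the child of the root, `m` generations up. -/
theorem exists_upperSingle_mem_pow {h : ℕ → ℕ} (hi : ∀ i < n, h i ≤ i) (m : ℕ) {j : Fin n}
    (hj : parentDepth h (j + 1) = m + 1) : ∃ (i : Fin n) (hij : i ≤ j),
      upperSingle hij (1 : F) ∈ supportIdeal F n h ^ m := by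
  induction m generalizing j with
  | zero =>
    refine ⟨j, le_rfl, ?_⟩
    rw [Submodule.pow_zero, Ideal.one_eq_top]
    exact Submodule.mem_top
  | succ m ih =>
    rw [parentDepth_succ h (hi j j.2), Nat.add_right_cancel_iff] at hj
    have h2 := hi j j.2
    match hk : h j with
    | 0 => rw [hk, parentDepth_zero] at hj; omega
    | k + 1 =>
      rw [hk] at hj h2
      obtain ⟨i, hij, h1⟩ := ih (j := ⟨k, by omega⟩) hj
      have hkj : (⟨k, by omega⟩ : Fin n) ≤ j := Fin.mk_le_of_le_val (by omega)
      refine ⟨i, hij.trans hkj, ?_⟩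
      rw [Submodule.pow_succ, ← mul_one (1 : F), ← upperSingle_mul hij hkj]
      refine Ideal.mul_mem_mul h1 ((upperSingle_mem_supportIdeal hkj).2 ?_)
      rw [hk]
      exact Nat.lt_succ_self k

theorem supportIdeal_pow_eq_bot_iff {h : ℕ → ℕ} (hm : ∀ i j, i ≤ j → j < n → h i ≤ h j)
    (hi : ∀ i < n, h i ≤ i) (d : ℕ) :
    supportIdeal F n h ^ d = ⊥ ↔ ∀ i ≤ n, parentDepth h i ≤ d := by
  have := supportIdeal_isTwoSided (F := F) hm
  constructor
  · intro hd j hj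
    match j, hj with
    | 0, _ => rw [parentDepth_zero]; exact Nat.zero_le d
    | j + 1, hj =>
      by_contra hlt
      obtain ⟨e, he⟩ : ∃ e, parentDepth h (j + 1) = (d + e) + 1 :=
        ⟨parentDepth h (j + 1) - d - 1, by omega⟩
      obtain ⟨i, hij, h1⟩ := exists_upperSingle_mem_pow (F := F) hi (d + e) (j := ⟨j, hj⟩) he
      rw [Ideal.IsTwoSided.pow_add, hd] at h1
      exact upperSingle_ne_zero hij ((Submodule.mem_bot _).1 (Ideal.mul_le_left h1))
  · intro hd
    rw [eq_bot_iff]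
    intro A hA
    rw [Submodule.mem_bot]
    refine Subtype.ext (Matrix.ext fun i j => ?_)
    by_contra hij
    have h1 := le_parentDepth_of_mem_pow hm hi d hA hij
    have h2 := hd (j + 1) j.2
    rw [parentDepth_succ h (hi i i.2)] at h1
    omega

theorem mem_nilpotentIdeals_iff {R : Type*} [Ring R] {d : ℕ} {I : Ideal R} :
    I ∈ nilpotentIdeals R d ↔ I.IsTwoSided ∧ I ^ d = ⊥ := by
  constructor
  · rintro ⟨h1, h2, h3⟩
    refine ⟨h1, ?_⟩
    -- Nilpotency makes the infimum attained; over the empty set it would be 0.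
    have h4 : I ^ nilpotencyClass I = 0 := Nat.sInf_mem (s := {k | I ^ k = 0}) h2
    rw [Ideal.zero_eq_bot] at h4
    rw [← Nat.add_sub_cancel' h3, Ideal.IsTwoSided.pow_add, h4, eq_bot_iff]
    exact Ideal.mul_le_left
  · rintro ⟨h1, h2⟩
    exact ⟨h1, ⟨d, h2⟩, Nat.sInf_le (s := {k | I ^ k = 0}) h2⟩

/-- Otherwise the ideal contains a diagonal matrix unit, a nonzero idempotent. -/
theorem le_of_supportIdeal_pow_eq_bot {h : ℕ → ℕ} {d : ℕ} (hd : supportIdeal F n h ^ d = ⊥) :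
    ∀ i < n, h i ≤ i := by
  intro i hi
  by_contra hlt
  have h1 : upperSingle (le_refl (⟨i, hi⟩ : Fin n)) (1 : F) ∈ supportIdeal F n h :=
    (upperSingle_mem_supportIdeal _).2 (not_le.1 hlt)
  have h2 := Ideal.pow_mem_pow h1 d
  rw [hd, Submodule.mem_bot] at h2
  have h3 : IsIdempotentElem (upperSingle (le_refl (⟨i, hi⟩ : Fin n)) (1 : F)) := by
    rw [IsIdempotentElem, upperSingle_mul, mul_one]
  have h4 := h3.pow_succ_eq d
  rw [pow_succ, h2, zero_mul] at h4
  exact upperSingle_ne_zero _ h4.symm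

variable (F n) in
theorem nilpotentIdeals_eq_image (d : ℕ) : nilpotentIdeals (UpperTriangular F n) d =
    supportIdeal F n '' parentFunctions d n := by
  ext I
  rw [mem_nilpotentIdeals_iff]
  constructor
  · rintro ⟨h1, h2⟩
    obtain ⟨h, hz, hm, rfl⟩ := exists_eq_supportIdeal I
    have hi := le_of_supportIdeal_pow_eq_bot h2
    exact ⟨h, ⟨hz, hm, hi, (supportIdeal_pow_eq_bot_iff hm hi d).1 h2⟩, rfl⟩
  · rintro ⟨h, ⟨-, hm, hi, hd⟩, rfl⟩
    exact ⟨supportIdeal_isTwoSided hm, (supportIdeal_pow_eq_bot_iff hm hi d).2 hd⟩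

variable (F) in
-- Since `h j ≤ j`, the first `h j` rows of column `j` lie above the diagonal, so the ideal sees all
-- of them.
theorem injOn_supportIdeal (d n : ℕ) :
    Set.InjOn (supportIdeal F n) (parentFunctions d n) := by
  have key : ∀ h ∈ parentFunctions d n, ∀ h', supportIdeal F n h ≤ supportIdeal F n h' →
      ∀ j, h j ≤ h' j := by
    intro h hh h' hle j
    by_contra hlt
    have hj : j < n := by
      by_contra hj
      have := hh.1 j (by omega)
      omega
    have h1 := hh.2.2.1 j hj
    have h2 : (⟨h' j, by omega⟩ : Fin n) ≤ ⟨j, hj⟩ := Fin.mk_le_mk.2 (by omega)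
    have h3 := hle ((upperSingle_mem_supportIdeal (F := F) (h := h) h2).2 (not_le.1 hlt))
    exact lt_irrefl _ ((upperSingle_mem_supportIdeal h2).1 h3)
  intro h hh h' hh' heq
  exact funext fun j => le_antisymm (key h hh h' heq.le j) (key h' hh' h heq.ge j)

variable (F) in
theorem encard_nilpotentIdeals (d n : ℕ) {c : ℕ}
    (hc : (c : ℚ) = PowerSeries.coeff n (heightSeries (d + 1))) :
    (nilpotentIdeals (UpperTriangular F n) d).encard = c := by
  rw [nilpotentIdeals_eq_image, (injOn_supportIdeal F d n).encard_image,
    encard_parentFunctions d n hc]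

variable (F) in
theorem commutativeIdeals_eq (hn : 2 ≤ n) :
    commutativeIdeals (UpperTriangular F n) = nilpotentIdeals (UpperTriangular F n) 2 := by
  ext I
  rw [mem_nilpotentIdeals_iff]
  refine and_congr_right fun hI => ?_
  rw [Submodule.pow_succ, Submodule.pow_one]
  constructor
  · intro hc
    -- A diagonal unit E_ii in the ideal would fail to commute with E_ij or E_ji for some `j ≠ i`;
    -- this is where `2 ≤ n` enters.
    have hdiag : ∀ A ∈ I, ∀ i, A.1 i i = 0 := by
      intro A hA i
      by_contra h
      have h1 := upperSingle_mem hA h le_rfl le_rfl le_rfl (1 : F)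
      have : Nontrivial (Fin n) := Fin.nontrivial_iff_two_le.2 hn
      obtain ⟨j, hj⟩ := exists_ne i
      rcases le_total i j with hij | hij
      · have h2 := hc _ h1 _ (upperSingle_mem hA h le_rfl hij hij (1 : F))
        rw [upperSingle_mul, upperSingle_mul_of_ne _ _ hj, mul_one] at h2
        exact upperSingle_ne_zero _ h2
      · have h2 := hc _ h1 _ (upperSingle_mem hA h hij le_rfl hij (1 : F))
        rw [upperSingle_mul, upperSingle_mul_of_ne _ _ hj.symm, mul_one] at h2
        exact upperSingle_ne_zero _ h2.symm
    rw [eq_bot_iff, Ideal.mul_le]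
    intro A hA B hB
    rw [Submodule.mem_bot]
    refine Subtype.ext (Matrix.ext fun i j => ?_)
    by_contra hij
    obtain ⟨k, h1, h2⟩ := UpperTriangular.exists_of_mul_ne_zero A B hij
    have hik := UpperTriangular.le_of_ne_zero A h1
    have hkj := UpperTriangular.le_of_ne_zero B h2
    have hne : i ≠ k := by
      rintro rfl
      exact h1 (hdiag A hA i)
    -- As i < k ≤ j, E_ik E_kj = E_ij while E_kj E_ik = 0.
    have h3 := hc _ (upperSingle_mem hA h1 le_rfl le_rfl hik (1 : F)) _
      (upperSingle_mem hB h2 le_rfl le_rfl hkj (1 : F))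
    have hji : j ≠ i := fun h => hne (le_antisymm hik (hkj.trans h.le))
    rw [upperSingle_mul, upperSingle_mul_of_ne _ _ hji, mul_one] at h3
    exact upperSingle_ne_zero _ h3
  · intro h2 A hA B hB
    have h3 : ∀ A ∈ I, ∀ B ∈ I, A * B = 0 := fun A hA B hB => by
      have := Ideal.mul_mem_mul hA hB
      rwa [h2, Submodule.mem_bot] at this
    rw [h3 A hA B hB, h3 B hB A hA]

end TwoSidedIdeals

theorem mainTheorem10 (F : Type*) [Field F] (n : ℕ) :
    (∀ d : ℕ, 1 ≤ d →
      (nilpotentIdeals (UpperTriangular F n) d).encard = (catalanDepth d n : ℕ∞)) ∧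
    (2 ≤ n →
      commutativeIdeals (UpperTriangular F n) = nilpotentIdeals (UpperTriangular F n) 2 ∧
      (commutativeIdeals (UpperTriangular F n)).encard = ((2 ^ (n - 1) : ℕ) : ℕ∞)) := by
  refine ⟨fun d hd => encard_nilpotentIdeals F d n (cast_catalanDepth hd n), fun hn =>
    ⟨commutativeIdeals_eq F hn, ?_⟩⟩
  rw [commutativeIdeals_eq F hn]
  refine encard_nilpotentIdeals F 2 n ?_
  obtain ⟨n, rfl⟩ := Nat.exists_eq_add_of_le' (one_le_two.trans hn)
  rw [coeff_heightSeries_three, Nat.add_sub_cancel]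
  push_cast
  rfl
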